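/- Let $E\subset\mathbb{C}$ be compact. Write $\|f\|_E=\sup_{z\in E}|f(z)|$ and let $\widehat E=\{z\in\mathbb{C} : |p(z)|\le\|p\|_E \text{ for all complex polynomials } p\}$ be its polynomially convex hull. The Green function of the unbounded domain $D_\infty=\mathbb{C}\setminus\widehat E$ with pole at infinity is the (unique, if it exists) positive harmonic function $g$ on $D_\infty$ such that $g(z)\to 0$ as $z\to\partial D_\infty$ and $g(z)-\log|z|$ tends to a finite limit as $z\to\infty$. The set $E$ is called regular if this function exists; it is then denoted by $g_E$ and extended to $\mathbb{C}$ by $g_E=0$ on $\widehat E$. Let $(C_n)_{n\ge 1}$ be real numbers with $\lim_{n\to\infty} C_n^{1/n}=1$. A sequence $(a_n)_{n\ge 0}$ of points of $E$ is a pseudo Leja sequence in $E$ of Edrei growth $(C_n)$ if, with $w_n(z)=\prod_{k=0}^{n-1}(z-a_k)$, $$C_n\,|w_n(a_n)|\ \ge\ \|w_n\|_E\qquad\text{for all } n\ge 1 .$$ Proposition. Let $E\subset\mathbb{C}$ be a regular compact set and let $(a_n)_{n\ge0}$ be a pseudo Leja sequence in $E$ of Edrei growth $(C_n)_{n\ge1}$.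 Then for all integers $1\le j\le n-1$, $$|a_j-a_n|\ \ge\ \frac{1}{2e\,C_n}\,\max\{\varrho_n(a_j),\varrho_n(a_n)\},$$ where $\varrho_n(z)=\operatorname{dist}\bigl(z,\{w\in\mathbb{C} : g_E(w)=\log(1+1/n)\}\bigr)$. -/

import Mathlib

open Filter Topology

noncomputable section

namespace PseudoLeja

/-- The supremum norm `‖f‖_E = sup_{z ∈ E} |f z|`, used for continuous `f` and compact `E`. -/
def supNormOn (E : Set ℂ) (f : ℂ → ℂ) : ℝ :=
  sSup ((fun z => ‖f z‖) '' E)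

/-- The polynomially convex hull of a compact set `E`: all points `z` with `|p z| ≤ ‖p‖_E` for
every complex polynomial `p`. -/
def polynomialHull (E : Set ℂ) : Set ℂ :=
  {z | ∀ p : Polynomial ℂ, ‖p.eval z‖ ≤ supNormOn E (fun w => p.eval w)}

/-- `g` is a Green function with pole at infinity of the unbounded domain `D`. Only the values of
`g` on `D` matter. -/
structure IsGreenFunction (D : Set ℂ) (g : ℂ → ℝ) : Prop where
  harmonic : InnerProductSpace.HarmonicOnNhd g D
  pos : ∀ z ∈ D, 0 < g z
  tendsto_boundary : ∀ ζ ∈ frontier D, Tendsto g (𝓝[D] ζ) (𝓝 0)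
  tendsto_infinity :
    ∃ γ : ℝ, Tendsto (fun z => g z - Real.log ‖z‖) (Bornology.cobounded ℂ ⊓ 𝓟 D) (𝓝 γ)

/-- A set is regular if the Green function with pole at infinity of the complement of its
polynomially convex hull exists. -/
def IsRegular (E : Set ℂ) : Prop :=
  ∃ g : ℂ → ℝ, IsGreenFunction (polynomialHull E)ᶜ g

open Classical in
/-- The Green function `g_E` of a regular compact set `E`, extended by `0` on the polynomially
convex hull of `E`. (It is the zero function if `E` is not regular.) -/
def greenFunction (E : Set ℂ) : ℂ → ℝ :=
  if h : IsRegular E then (polynomialHull E)ᶜ.indicator h.choose else 0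

/-- The nodal polynomial `w_n(z) = (z - a_0) ⋯ (z - a_{n-1})`. -/
def nodal (a : ℕ → ℂ) (n : ℕ) (z : ℂ) : ℂ :=
  ∏ k ∈ Finset.range n, (z - a k)

/-- `a_0, a_1, …` is a pseudo Leja sequence in `E` of Edrei growth `C_1, C_2, …`
(the value `C 0` plays no role). -/
structure IsPseudoLeja (E : Set ℂ) (C : ℕ → ℝ) (a : ℕ → ℂ) : Prop where
  growth : Tendsto (fun n : ℕ => C n ^ (1 / (n : ℝ))) atTop (𝓝 1)
  mem : ∀ n, a n ∈ E
  le : ∀ n, 1 ≤ n → supNormOn E (nodal a n) ≤ C n * ‖nodal a n (a n)‖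

/-- `ϱ_n(z)`, the distance from `z` to the level set `{w : g_E(w) = log (1 + 1/n)}`. -/
def levelDist (E : Set ℂ) (n : ℕ) (z : ℂ) : ℝ :=
  Metric.infDist z {w | greenFunction E w = Real.log (1 + 1 / (n : ℝ))}

end PseudoLeja

end

namespace PseudoLeja

/-! Since `j < n`, the polynomial w_n vanishes at a_j, while |w_n(a_n)| ≥ ‖w_n‖_E / C_n; the two
points cannot be close if w_n varies slowly. Bernstein–Walsh gives |w_n| ≤ ‖w_n‖_E exp(n g_E). On
the disc of radius ϱ_n(c) about c ∈ E one has g_E < log(1 + 1/n) ≤ 1/n, so |w_n| ≤ e‖w_n‖_E there,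
and the Schwarz lemma yields ϱ_n(c)|w_n(z) - w_n(c)| ≤ 2e‖w_n‖_E |z - c|
(`levelDist_mul_norm_sub_le`). Centring at a_j and at a_n gives both terms of the maximum. -/

lemma IsGreenFunction.tendsto_cobounded {D : Set ℂ} {g : ℂ → ℝ} (hg : IsGreenFunction D g)
    (hD : D ∈ Bornology.cobounded ℂ) :
    ∃ γ : ℝ, Tendsto (fun z => g z - Real.log ‖z‖) (Bornology.cobounded ℂ) (𝓝 γ) := by
  obtain ⟨γ, hγ⟩ := hg.tendsto_infinity
  rw [inf_eq_left.mpr (le_principal_iff.mpr hD)] at hγ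
  exact ⟨γ, hγ⟩

lemma IsGreenFunction.tendsto_cobounded_atTop {D : Set ℂ} {g : ℂ → ℝ} (hg : IsGreenFunction D g)
    (hD : D ∈ Bornology.cobounded ℂ) : Tendsto g (Bornology.cobounded ℂ) atTop := by
  obtain ⟨γ, hγ⟩ := hg.tendsto_cobounded hD
  have hlog : Tendsto (fun z : ℂ => Real.log ‖z‖) (Bornology.cobounded ℂ) atTop :=
    Real.tendsto_log_atTop.comp tendsto_norm_cobounded_atTop
  simpa using hγ.add_atTop hlog

lemma IsGreenFunction.tendsto_norm_sub_mul_exp_neg {D : Set ℂ} {g : ℂ → ℝ}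
    (hg : IsGreenFunction D g) (hD : D ∈ Bornology.cobounded ℂ) :
    ∃ γ : ℝ, ∀ c : ℂ, Tendsto (fun z => ‖z - c‖ * Real.exp (-g z)) (Bornology.cobounded ℂ)
      (𝓝 (Real.exp (-γ))) := by
  obtain ⟨γ, hγ⟩ := hg.tendsto_cobounded hD
  refine ⟨γ, fun c => ?_⟩
  have hne : ∀ᶠ z : ℂ in Bornology.cobounded ℂ, z ≠ 0 :=
    Bornology.eventually_ne_cobounded 0
  have hratio : Tendsto (fun z : ℂ => ‖1 - c * z⁻¹‖) (Bornology.cobounded ℂ) (𝓝 1) := by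
    have h := ((tendsto_inv₀_cobounded (α := ℂ)).const_mul c).const_sub 1
    simpa using h.norm
  have hexp := (Real.continuous_exp.tendsto _).comp hγ.neg
  have h := hratio.mul hexp
  rw [one_mul] at h
  refine h.congr' ?_
  filter_upwards [hne] with z hz
  have hz' : 0 < ‖z‖ := norm_pos_iff.mpr hz
  have h1 : ‖z - c‖ = ‖1 - c * z⁻¹‖ * ‖z‖ := by
    rw [← norm_mul]; congr 1; field_simp
  simp only [Function.comp_apply]
  rw [h1, neg_sub, sub_eq_add_neg (Real.log _), Real.exp_add, Real.exp_log hz', mul_assoc]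

lemma IsGreenFunction.continuous_indicator {K : Set ℂ} {g : ℂ → ℝ}
    (hg : IsGreenFunction Kᶜ g) (hK : IsClosed K) : Continuous (Kᶜ.indicator g) := by
  rw [continuous_iff_continuousAt]
  intro z
  by_cases hz : z ∈ K
  · have hval : Kᶜ.indicator g z = 0 := Set.indicator_of_notMem (by simpa using hz) g
    rw [ContinuousAt, hval, ← nhdsWithin_univ, ← Set.union_compl_self K, nhdsWithin_union]
    refine Tendsto.sup ?_ ?_
    · refine tendsto_const_nhds.congr' ?_
      filter_upwards [self_mem_nhdsWithin] with w hw
      exact (Set.indicator_of_notMem (by simpa using hw) g).symm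
    · by_cases hfr : z ∈ frontier Kᶜ
      · refine (hg.tendsto_boundary z hfr).congr' ?_
        filter_upwards [self_mem_nhdsWithin] with w hw
        exact (Set.indicator_of_mem hw g).symm
      -- At an interior point of K the filter `𝓝[Kᶜ] z` is trivial.
      · have hcl : z ∉ closure Kᶜ := fun h => hfr ⟨h, fun h' => interior_subset h' hz⟩
        rw [mem_closure_iff_nhdsWithin_neBot, not_neBot] at hcl
        rw [hcl]
        exact tendsto_bot
  · have hc : ContinuousAt g z := (hg.harmonic z hz).1.continuousAt
    refine hc.congr ?_
    filter_upwards [hK.isOpen_compl.mem_nhds hz] with w hw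
    exact (Set.indicator_of_mem hw g).symm

/-- The local maximum principle for `|f| * exp (-s * g)`, with `f` entire and `g` harmonic. -/
lemma eventually_eq_of_isLocalMax_norm_mul_exp {U : Set ℂ} (hU : IsOpen U) {g : ℂ → ℝ}
    (hg : InnerProductSpace.HarmonicOnNhd g U) {f : ℂ → ℂ} (hf : Differentiable ℂ f) (s : ℝ)
    {z : ℂ} (hz : z ∈ U) (hmax : IsLocalMax (fun w => ‖f w‖ * Real.exp (-(s * g w))) z) :
    ∀ᶠ w in 𝓝 z, ‖f w‖ * Real.exp (-(s * g w)) = ‖f z‖ * Real.exp (-(s * g z)) := by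
  obtain ⟨r, hr, hball⟩ := Metric.isOpen_iff.mp hU z hz
  -- Locally g = Re F with F holomorphic, so the function is the modulus of f exp(-sF).
  obtain ⟨F, hF, hFg⟩ :=
    InnerProductSpace.HarmonicOnNhd.exists_analyticOnNhd_ball_re_eq (hg.mono hball)
  have hnhds : Metric.ball z r ∈ 𝓝 z := Metric.ball_mem_nhds z hr
  have hnorm : ∀ w ∈ Metric.ball z r,
      ‖f w * Complex.exp (-(s * F w))‖ = ‖f w‖ * Real.exp (-(s * g w)) := by
    intro w hw
    have h : (F w).re = g w := hFg hw
    simp [Complex.norm_exp, h]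
  have hzz := hnorm z (Metric.mem_ball_self hr)
  have hd : ∀ᶠ w in 𝓝 z, DifferentiableAt ℂ (fun w => f w * Complex.exp (-(s * F w))) w := by
    filter_upwards [hnhds] with w hw
    have := (hF w hw).differentiableAt
    have := hf w
    fun_prop
  have hloc : IsLocalMax (norm ∘ fun w => f w * Complex.exp (-(s * F w))) z := by
    filter_upwards [hmax, hnhds] with w hw hwb
    simp only [Function.comp_apply]
    rw [hnorm w hwb, hzz]
    exact hw
  filter_upwards [Complex.norm_eventually_eq_of_isLocalMax hd hloc, hnhds] with w hw hwb
  rw [← hnorm w hwb, ← hzz, hw]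

/-! ### Bernstein–Walsh inequality for nodal polynomials -/

lemma nodal_differentiable (a : ℕ → ℂ) (n : ℕ) : Differentiable ℂ (nodal a n) := by
  unfold nodal
  fun_prop

lemma norm_nodal_mul_exp (a : ℕ → ℂ) (n : ℕ) (z : ℂ) (t : ℝ) :
    ‖nodal a n z‖ * Real.exp (-(n * t)) =
      ∏ k ∈ Finset.range n, (‖z - a k‖ * Real.exp (-t)) := by
  rw [Finset.prod_mul_distrib, nodal, norm_prod, Finset.prod_const, Finset.card_range,
    ← Real.exp_nat_mul, mul_neg]

/-- With exponent n alone the function has only a finite limit at infinity; the extra ε makes it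
tend to 0, so a value above M forces a maximum to be attained. -/
lemma IsGreenFunction.norm_nodal_mul_exp_le {K : Set ℂ} {g : ℂ → ℝ}
    (hg : IsGreenFunction Kᶜ g) (hK : IsCompact K) {a : ℕ → ℂ} {n : ℕ} {M : ℝ}
    (hM0 : 0 < M) (hM : ∀ z ∈ K, ‖nodal a n z‖ ≤ M) {ε : ℝ} (hε : 0 < ε) (z : ℂ) :
    ‖nodal a n z‖ * Real.exp (-((n + ε) * Kᶜ.indicator g z)) ≤ M := by
  set G := Kᶜ.indicator g with hG
  set v : ℂ → ℝ := fun z => ‖nodal a n z‖ * Real.exp (-((n + ε) * G z)) with hv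
  have hGc : Continuous G := hg.continuous_indicator hK.isClosed
  have hvc : Continuous v := by
    have := (nodal_differentiable a n).continuous
    fun_prop
  have hcob : Kᶜ ∈ Bornology.cobounded ℂ := hK.isBounded
  have hlim : Tendsto v (Bornology.cobounded ℂ) (𝓝 0) := by
    obtain ⟨γ, hγ⟩ := hg.tendsto_norm_sub_mul_exp_neg hcob
    have h1 := tendsto_finsetProd (Finset.range n) fun k _ => hγ (a k)
    have h2 : Tendsto (fun z => Real.exp (-(ε * g z))) (Bornology.cobounded ℂ) (𝓝 0) :=
      Real.tendsto_exp_neg_atTop_nhds_zero.comp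
        ((hg.tendsto_cobounded_atTop hcob).const_mul_atTop hε)
    have h := h1.mul h2
    rw [mul_zero] at h
    refine h.congr' ?_
    filter_upwards [hcob] with w hw
    have hGw : G w = g w := Set.indicator_of_mem hw g
    rw [← norm_nodal_mul_exp, mul_assoc, ← Real.exp_add, hv]
    simp only [hGw]
    ring_nf
  by_contra! hlt
  have hev : ∀ᶠ w in cocompact ℂ, v w ≤ v z := by
    rw [← Metric.cobounded_eq_cocompact]
    exact (hlim.eventually_lt_const (hM0.trans hlt)).mono fun _ h => h.le
  obtain ⟨z₀, hz₀⟩ := hvc.exists_forall_ge' z hev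
  have hMlt : M < v z₀ := hlt.trans_le (hz₀ z)
  -- The maximum set avoids K, where v ≤ M, so the local maximum principle makes it open. Being
  -- clopen, it is all of ℂ, contradicting the limit 0.
  have hopen : IsOpen {w | v w = v z₀} := by
    rw [isOpen_iff_mem_nhds]
    intro w hw
    have hw' : v w = v z₀ := hw
    have hwK : w ∈ Kᶜ := by
      intro hmem
      have hGw : G w = 0 := Set.indicator_of_notMem (by simpa using hmem) g
      have : v w ≤ M := by simpa [hv, hGw] using hM w hmem
      linarith
    have heq : v =ᶠ[𝓝 w] fun y => ‖nodal a n y‖ * Real.exp (-((n + ε) * g y)) := by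
      filter_upwards [hK.isClosed.isOpen_compl.mem_nhds hwK] with y hy
      have hGy : G y = g y := Set.indicator_of_mem hy g
      simp only [hv, hGy]
    have hmax : IsLocalMax v w := Eventually.of_forall fun y => (hz₀ y).trans hw'.ge
    have hloc := eventually_eq_of_isLocalMax_norm_mul_exp hK.isClosed.isOpen_compl hg.harmonic
      (nodal_differentiable a n) (n + ε) hwK (hmax.congr heq)
    filter_upwards [hloc, heq] with y hy hvy
    exact (hvy.trans (hy.trans heq.eq_of_nhds.symm)).trans hw'
  have hclopen : IsClopen {w | v w = v z₀} := ⟨isClosed_eq hvc continuous_const, hopen⟩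
  have huniv : {w | v w = v z₀} = Set.univ := hclopen.eq_univ ⟨z₀, rfl⟩
  have hconst : Tendsto v (Bornology.cobounded ℂ) (𝓝 (v z₀)) :=
    tendsto_const_nhds.congr fun w => (huniv ▸ Set.mem_univ w : w ∈ {w | v w = v z₀}).symm
  have := tendsto_nhds_unique hconst hlim
  linarith

/-- The Bernstein–Walsh inequality for nodal polynomials. -/
lemma IsGreenFunction.norm_nodal_le {K : Set ℂ} {g : ℂ → ℝ}
    (hg : IsGreenFunction Kᶜ g) (hK : IsCompact K) {a : ℕ → ℂ} {n : ℕ} {M : ℝ}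
    (hM0 : 0 < M) (hM : ∀ z ∈ K, ‖nodal a n z‖ ≤ M) (z : ℂ) :
    ‖nodal a n z‖ ≤ M * Real.exp (n * Kᶜ.indicator g z) := by
  have hlim : Tendsto (fun ε : ℝ => ‖nodal a n z‖ * Real.exp (-((n + ε) * Kᶜ.indicator g z)))
      (𝓝[>] 0) (𝓝 (‖nodal a n z‖ * Real.exp (-((n + 0) * Kᶜ.indicator g z)))) := by
    refine Tendsto.mono_left (Continuous.tendsto ?_ 0) nhdsWithin_le_nhds
    fun_prop
  have h := le_of_tendsto hlim (by
    filter_upwards [self_mem_nhdsWithin] with ε hε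
    exact hg.norm_nodal_mul_exp_le hK hM0 hM hε z)
  rwa [add_zero, Real.exp_neg, ← div_eq_mul_inv, div_le_iff₀ (Real.exp_pos _)] at h

/-! ### Polynomial hulls and regular compact sets -/

lemma norm_le_supNormOn {E : Set ℂ} (hE : IsCompact E) {f : ℂ → ℂ} (hf : Continuous f) {z : ℂ}
    (hz : z ∈ E) : ‖f z‖ ≤ supNormOn E f :=
  le_csSup (hE.image hf.norm).bddAbove ⟨z, hz, rfl⟩

lemma subset_polynomialHull {E : Set ℂ} (hE : IsCompact E) : E ⊆ polynomialHull E :=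
  fun _ hz p => norm_le_supNormOn hE p.continuous hz

lemma isCompact_polynomialHull (E : Set ℂ) : IsCompact (polynomialHull E) := by
  refine Metric.isCompact_of_isClosed_isBounded ?_ ?_
  · rw [polynomialHull, Set.ofPred_forall]
    exact isClosed_iInter fun p => isClosed_le p.continuous.norm continuous_const
  · refine isBounded_iff_forall_norm_le.mpr
      ⟨supNormOn E fun w => (Polynomial.X : Polynomial ℂ).eval w, fun z hz => ?_⟩
    simpa only [Polynomial.eval_X] using hz Polynomial.X

lemma norm_nodal_le_supNormOn {E : Set ℂ} (a : ℕ → ℂ) (n : ℕ) {z : ℂ}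
    (hz : z ∈ polynomialHull E) : ‖nodal a n z‖ ≤ supNormOn E (nodal a n) := by
  have h := hz (∏ k ∈ Finset.range n, (Polynomial.X - Polynomial.C (a k)))
  simp only [Polynomial.eval_prod, Polynomial.eval_sub, Polynomial.eval_X, Polynomial.eval_C] at h
  exact h

lemma exists_isGreenFunction_greenFunction_eq {E : Set ℂ} (hreg : IsRegular E) :
    ∃ g, IsGreenFunction (polynomialHull E)ᶜ g ∧
      greenFunction E = (polynomialHull E)ᶜ.indicator g :=
  ⟨hreg.choose, hreg.choose_spec, by rw [greenFunction, dif_pos hreg]⟩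

lemma continuous_greenFunction {E : Set ℂ} (hreg : IsRegular E) :
    Continuous (greenFunction E) := by
  obtain ⟨g, hg, h⟩ := exists_isGreenFunction_greenFunction_eq hreg
  exact h ▸ hg.continuous_indicator (isCompact_polynomialHull E).isClosed

lemma greenFunction_eq_zero {E : Set ℂ} (hE : IsCompact E) (hreg : IsRegular E) {z : ℂ}
    (hz : z ∈ E) : greenFunction E z = 0 := by
  obtain ⟨g, -, h⟩ := exists_isGreenFunction_greenFunction_eq hreg
  rw [h]
  exact Set.indicator_of_notMem (by simpa using subset_polynomialHull hE hz) g

lemma norm_nodal_le_mul_exp_greenFunction {E : Set ℂ} (hreg : IsRegular E) {a : ℕ → ℂ} {n : ℕ}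
    {M : ℝ} (hM0 : 0 < M) (hM : supNormOn E (nodal a n) ≤ M) (z : ℂ) :
    ‖nodal a n z‖ ≤ M * Real.exp (n * greenFunction E z) := by
  obtain ⟨g, hg, h⟩ := exists_isGreenFunction_greenFunction_eq hreg
  rw [h]
  exact hg.norm_nodal_le (isCompact_polynomialHull E) hM0
    (fun w hw => (norm_nodal_le_supNormOn a n hw).trans hM) z

/-- On a regular compact set a nodal polynomial does not vanish identically. -/
lemma supNormOn_nodal_pos {E : Set ℂ} (hreg : IsRegular E) (a : ℕ → ℂ) (n : ℕ) :
    0 < supNormOn E (nodal a n) := by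
  by_contra! hle
  obtain ⟨z, hz⟩ := (Finset.range n).image a |>.exists_notMem
  have hne : nodal a n z ≠ 0 := by
    refine Finset.prod_ne_zero_iff.mpr fun k hk => sub_ne_zero.mpr ?_
    rintro rfl
    exact hz (Finset.mem_image_of_mem a hk)
  -- If the norm were not positive, Bernstein–Walsh would hold with every M > 0, forcing w_n to
  -- vanish off its roots.
  have hlim : Tendsto (fun M : ℝ => M * Real.exp (n * greenFunction E z)) (𝓝[>] 0) (𝓝 0) := by
    have : Continuous fun M : ℝ => M * Real.exp (n * greenFunction E z) := by fun_prop
    simpa using (this.tendsto 0).mono_left nhdsWithin_le_nhds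
  have h := ge_of_tendsto hlim (by
    filter_upwards [self_mem_nhdsWithin] with M hM
    exact norm_nodal_le_mul_exp_greenFunction hreg hM (hle.trans (le_of_lt hM)) z)
  exact hne (norm_le_zero_iff.mp h)

/-! ### Schwarz estimate on discs inside the level curve -/

/-- As g_E(c) = 0, a larger value in the disc would, by the intermediate value theorem, put a point
of the level set closer to c than its distance. -/
lemma greenFunction_lt_of_mem_ball {E : Set ℂ} (hE : IsCompact E) (hreg : IsRegular E) {n : ℕ}
    (hn : 0 < n) {c z : ℂ} (hc : c ∈ E) (hz : z ∈ Metric.ball c (levelDist E n c)) :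
    greenFunction E z < Real.log (1 + 1 / (n : ℝ)) := by
  by_contra! hle
  have hn' : (0 : ℝ) < 1 / n := by positivity
  have hpos : 0 < Real.log (1 + 1 / (n : ℝ)) := Real.log_pos (by linarith)
  have hr : 0 < levelDist E n c := Metric.pos_of_mem_ball hz
  obtain ⟨w, hw, hwl⟩ := (convex_ball c (levelDist E n c)).isPreconnected.intermediate_value
    (Metric.mem_ball_self hr) hz (continuous_greenFunction hreg).continuousOn
    ⟨(greenFunction_eq_zero hE hreg hc).trans_le hpos.le, hle⟩
  have h : levelDist E n c ≤ dist c w := Metric.infDist_le_dist_of_mem hwl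
  rw [dist_comm] at h
  exact absurd (Metric.mem_ball.mp hw) h.not_gt

lemma norm_nodal_le_of_mem_ball {E : Set ℂ} (hE : IsCompact E) (hreg : IsRegular E) (a : ℕ → ℂ)
    {n : ℕ} (hn : 0 < n) {c z : ℂ} (hc : c ∈ E) (hz : z ∈ Metric.ball c (levelDist E n c)) :
    ‖nodal a n z‖ ≤ Real.exp 1 * supNormOn E (nodal a n) := by
  have hpos := supNormOn_nodal_pos hreg a n
  have hn' : (0 : ℝ) < n := by exact_mod_cast hn
  have hlt := greenFunction_lt_of_mem_ball hE hreg hn hc hz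
  have hlog : Real.log (1 + 1 / (n : ℝ)) ≤ 1 / n := by
    have := Real.log_le_sub_one_of_pos (show (0 : ℝ) < 1 + 1 / n by positivity)
    linarith
  have hone : n * greenFunction E z ≤ 1 := by
    have := mul_le_mul_of_nonneg_left (hlt.le.trans hlog) hn'.le
    rwa [mul_one_div_cancel hn'.ne'] at this
  calc ‖nodal a n z‖ ≤ supNormOn E (nodal a n) * Real.exp (n * greenFunction E z) :=
        norm_nodal_le_mul_exp_greenFunction hreg hpos le_rfl z
    _ ≤ supNormOn E (nodal a n) * Real.exp 1 := by gcongr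
    _ = _ := mul_comm _ _

/-- A Schwarz lemma estimate for a nodal polynomial between two points of `E`. -/
lemma levelDist_mul_norm_sub_le {E : Set ℂ} (hE : IsCompact E) (hreg : IsRegular E) (a : ℕ → ℂ)
    {n : ℕ} (hn : 0 < n) {c z : ℂ} (hc : c ∈ E) (hz : z ∈ E) :
    levelDist E n c * ‖nodal a n z - nodal a n c‖ ≤
      2 * Real.exp 1 * supNormOn E (nodal a n) * ‖z - c‖ := by
  have hd := nodal_differentiable a n
  have hpos := supNormOn_nodal_pos hreg a n
  have hone : (1 : ℝ) ≤ Real.exp 1 := Real.one_le_exp zero_le_one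
  have hρ : 0 ≤ levelDist E n c := Metric.infDist_nonneg
  have hc' := norm_le_supNormOn hE hd.continuous hc
  have hz' := norm_le_supNormOn hE hd.continuous hz
  by_cases hball : z ∈ Metric.ball c (levelDist E n c)
  · have hr : 0 < levelDist E n c := Metric.pos_of_mem_ball hball
    -- The radius 2e‖w_n‖_E comes from e‖w_n‖_E for w_n(w) plus ‖w_n‖_E for w_n(c).
    have hmaps : Set.MapsTo (nodal a n) (Metric.ball c (levelDist E n c))
        (Metric.closedBall (nodal a n c) (2 * Real.exp 1 * supNormOn E (nodal a n))) := by
      intro w hw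
      rw [mem_closedBall_iff_norm]
      have := norm_nodal_le_of_mem_ball hE hreg a hn hc hw
      have := norm_sub_le (nodal a n w) (nodal a n c)
      nlinarith
    have h := Complex.dist_le_div_mul_dist_of_mapsTo_ball hd.differentiableOn hmaps hball
    rw [dist_eq_norm, dist_eq_norm, div_mul_eq_mul_div, le_div_iff₀ hr] at h
    linarith
  -- Outside the disc ϱ_n(c) ≤ |z - c|, and the trivial bound on the difference suffices.
  · rw [mem_ball_iff_norm, not_lt] at hball
    have h1 : ‖nodal a n z - nodal a n c‖ ≤ 2 * Real.exp 1 * supNormOn E (nodal a n) := by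
      have := norm_sub_le (nodal a n z) (nodal a n c)
      nlinarith
    calc _ ≤ ‖z - c‖ * (2 * Real.exp 1 * supNormOn E (nodal a n)) := by gcongr
      _ = _ := mul_comm _ _

end PseudoLeja

theorem mainTheorem7 (E : Set ℂ) (hE : IsCompact E) (hreg : PseudoLeja.IsRegular E)
    (C : ℕ → ℝ) (a : ℕ → ℂ) (ha : PseudoLeja.IsPseudoLeja E C a)
    (n j : ℕ) (hj : 1 ≤ j) (hjn : j < n) :
    1 / (2 * Real.exp 1 * C n) *
        max (PseudoLeja.levelDist E n (a j)) (PseudoLeja.levelDist E n (a n)) ≤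
      ‖a j - a n‖ := by
  have hn : 0 < n := hj.trans hjn.le
  have hpos := PseudoLeja.supNormOn_nodal_pos hreg a n
  have hle := ha.le n hn
  have hnorm : 0 < ‖PseudoLeja.nodal a n (a n)‖ := by
    refine (norm_nonneg _).lt_of_ne fun h => ?_
    rw [← h, mul_zero] at hle
    exact hpos.not_ge hle
  -- Positivity of C_n is not assumed; it follows from ‖w_n‖_E > 0.
  have hC : 0 < C n := pos_of_mul_pos_left (hpos.trans_le hle) hnorm.le
  have hzero : PseudoLeja.nodal a n (a j) = 0 :=
    Finset.prod_eq_zero (Finset.mem_range.mpr hjn) (sub_self _)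
  have key : ∀ ρ : ℝ, ρ * ‖PseudoLeja.nodal a n (a n)‖ ≤
      2 * Real.exp 1 * PseudoLeja.supNormOn E (PseudoLeja.nodal a n) * ‖a j - a n‖ →
      ρ ≤ ‖a j - a n‖ * (2 * Real.exp 1 * C n) := by
    intro ρ h
    refine le_of_mul_le_mul_right ?_ hnorm
    calc _ ≤ _ := h
      _ ≤ 2 * Real.exp 1 * (C n * ‖PseudoLeja.nodal a n (a n)‖) * ‖a j - a n‖ := by gcongr
      _ = _ := by ring
  rw [one_div_mul_eq_div, div_le_iff₀ (by positivity)]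
  refine max_le (key _ ?_) (key _ ?_)
  · have h := PseudoLeja.levelDist_mul_norm_sub_le hE hreg a hn (ha.mem j) (ha.mem n)
    rwa [hzero, sub_zero, norm_sub_rev (a n) (a j)] at h
  · have h := PseudoLeja.levelDist_mul_norm_sub_le hE hreg a hn (ha.mem n) (ha.mem j)
    rwa [hzero, zero_sub, norm_neg] at h
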